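/- For $n\in\mathbb N=\{0,1,2,\dots\}$ let $\mathrm{He}_n(x)=(-1)^n e^{x^2/2}\frac{d^n}{dx^n}e^{-x^2/2}$, and for $\theta>0$, $\alpha\in\mathbb N^3$, $v=(v_1,v_2,v_3)\in\mathbb R^3$ put $$\mathcal H_{\theta,\alpha}(v)=\prod_{d=1}^3\frac1{\sqrt{2\pi}}\,\theta^{-\frac{\alpha_d+1}2}\,\mathrm{He}_{\alpha_d}(v_d)\,e^{-v_d^2/2},\qquad C_{\theta,\alpha}=\frac{(2\pi)^{3/2}\theta^{|\alpha|+3}}{\alpha_1!\,\alpha_2!\,\alpha_3!},$$ where $|\alpha|=\alpha_1+\alpha_2+\alpha_3$. For $m\ge1$, $n\ge0$ let $$K(m,n)=\frac{1}{\sqrt{2\pi}\,m!}\,\mathrm{He}_{m-1}(0)\,\mathrm{He}_n(0),$$ and define $S(m,n)$ for $m,n\ge 0$ recursively by $$S(m,n)=\begin{cases}1/2,& m=n=0,\\ K(1,n-1),& m=0,\ n\ne0,\\ K(m,0),& m\neq0,\ n=0,\\ K(m,n)+\frac nm\,S(m-1,n-1),&\text{otherwise.}\end{cases}$$ Finally let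 $$I_{\alpha,\beta}(\theta)=S(\alpha_2,\beta_2)\,\theta^{\frac{\alpha_2-\beta_2}2}\,\delta_{\alpha_1\beta_1}\delta_{\alpha_3\beta_3}.$$ **Proposition.** Let $\theta>0$, $M\in\mathbb N$, and let $g:\mathbb R^3\to\mathbb R$ be a finite Hermite expansion $g(v)=\sum_{|\beta|\le M+1}g_\beta\,\mathcal H_{\theta,\beta}(v)$ with real coefficients $g_\beta$. Let $\tilde g(v)=g(v)$ if $v_2\ge0$ and $\tilde g(v)=0$ if $v_2<0$. Then: 1. For all $\alpha,\beta\in\mathbb N^3$ the following integral converges absolutely and $$C_{\theta,\alpha}\int_{\{v_2\ge0\}}\mathcal H_{\theta,\alpha}(v)\,\mathcal H_{\theta,\beta}(v)\,e^{|v|^2/2}\,dv=I_{\alpha,\beta}(\theta).$$ 2. The functions $\mathcal H_{\theta,\alpha}$ $(\alpha\in\mathbb N^3)$ and $\tilde g$ belong to $L^2(\mathbb R^3;e^{|v|^2/2}dv)$, and $$\tilde g=\sum_{\alpha\in\mathbb N^3}\Big(\sum_{|\beta|\le M+1}g_\beta\,I_{\alpha,\beta}(\theta)\Big)\mathcal H_{\theta,\alpha},$$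 where the series over $\alpha$ converges unconditionally in $L^2(\mathbb R^3;e^{|v|^2/2}dv)$. -/

import Mathlib

open MeasureTheory

noncomputable section

namespace HalfSpaceHermite

/-- Velocity space `ℝ³`. The coordinates `v₁, v₂, v₃` are `v 0, v 1, v 2`. -/
abbrev Vel : Type := EuclideanSpace ℝ (Fin 3)

/-- Multi-indices `α ∈ ℕ³`; `α₁, α₂, α₃` are `α 0, α 1, α 2`. -/
abbrev MIdx : Type := Fin 3 → ℕ

/-- The probabilists' Hermite polynomial `He_n`, as a real function. -/
def He (n : ℕ) (x : ℝ) : ℝ := Polynomial.aeval x (Polynomial.hermite n)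

/-- Rodrigues' formula `He_n(x) = (-1)ⁿ exp(x²/2) dⁿ/dxⁿ exp(-x²/2)`. -/
theorem He_eq_rodrigues (n : ℕ) (x : ℝ) :
    He n x = (-1) ^ n * Real.exp (x ^ 2 / 2) *
      iteratedDeriv n (fun y : ℝ => Real.exp (-(y ^ 2 / 2))) x := by
  rw [He, Polynomial.hermite_eq_deriv_gaussian', iteratedDeriv_eq_iterate]
  ring

/-- The basis function
`H_{θ,α}(v) = ∏_d (2π)^{-1/2} θ^{-(α_d+1)/2} He_{α_d}(v_d) exp(-v_d²/2)`. -/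
def basisH (θ : ℝ) (α : MIdx) (v : Vel) : ℝ :=
  ∏ d : Fin 3, 1 / Real.sqrt (2 * Real.pi) * θ ^ (-((α d : ℝ) + 1) / 2) *
    He (α d) (v d) * Real.exp (-(v d) ^ 2 / 2)

/-- The normalization constant `C_{θ,α} = (2π)^{3/2} θ^{|α|+3} / (α₁! α₂! α₃!)`. -/
def normC (θ : ℝ) (α : MIdx) : ℝ :=
  (2 * Real.pi) ^ (3 / 2 : ℝ) * θ ^ ((∑ d, α d) + 3) / ∏ d, ((α d).factorial : ℝ)

/-- The closed half-space `{v₂ ≥ 0}`. -/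
def halfSpace : Set Vel := {v | 0 ≤ v 1}

/-- The half-space cut-off: `g` where `v₂ ≥ 0`, and `0` where `v₂ < 0`. -/
def cutoff (g : Vel → ℝ) : Vel → ℝ := halfSpace.indicator g

/-- The weighted measure `exp(|v|²/2) dv`. -/
def weight : Measure Vel :=
  (volume : Measure Vel).withDensity fun v => ENNReal.ofReal (Real.exp (‖v‖ ^ 2 / 2))

/-- The multi-indices `β` with `|β| ≤ N`. -/
def idxLE (N : ℕ) : Finset MIdx :=
  (Fintype.piFinset fun _ : Fin 3 => Finset.range (N + 1)).filter fun β => ∑ d, β d ≤ N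

theorem mem_idxLE {N : ℕ} {β : MIdx} : β ∈ idxLE N ↔ ∑ d, β d ≤ N := by
  simp only [idxLE, Finset.mem_filter, Fintype.mem_piFinset, Finset.mem_range,
    and_iff_right_iff_imp]
  intro h d
  have := Finset.single_le_sum (f := β) (fun i _ => Nat.zero_le _) (Finset.mem_univ d)
  omega

/-- The integrand `H_{θ,α}(v) H_{θ,β}(v) exp(|v|²/2)`. -/
def integrandI (θ : ℝ) (α β : MIdx) (v : Vel) : ℝ :=
  basisH θ α v * basisH θ β v * Real.exp (‖v‖ ^ 2 / 2)

/-- `K(m,n) = (2π)^{-1/2} He_{m-1}(0) He_n(0) / m!`, with the convention `He_{-1} = 0`. -/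
def K : ℕ → ℕ → ℝ
  | 0, _ => 0
  | m + 1, n => 1 / Real.sqrt (2 * Real.pi) / ((m + 1).factorial : ℝ) * He m 0 * He n 0

/-- `S(0,0) = 1/2`, `S(0,n) = K(1,n-1)` and `S(m,0) = K(m,0)` for `m, n ≥ 1`, and
`S(m,n) = K(m,n) + S(m-1,n-1) n/m` for `m, n ≥ 1`. -/
def S : ℕ → ℕ → ℝ
  | 0, 0 => 1 / 2
  | 0, n + 1 => K 1 n
  | m + 1, 0 => K (m + 1) 0
  | m + 1, n + 1 => K (m + 1) (n + 1) + S m n * (((n + 1 : ℕ) : ℝ) / ((m + 1 : ℕ) : ℝ))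

/-- The coefficient
`I_{α,β}(θ) = S(α₂,β₂) θ^{(α₂-β₂)/2} δ_{α₁β₁} δ_{α₃β₃}`. -/
def coeffI (θ : ℝ) (α β : MIdx) : ℝ :=
  S (α 1) (β 1) * θ ^ (((α 1 : ℝ) - (β 1 : ℝ)) / 2) *
    (if α 0 = β 0 then 1 else 0) * (if α 2 = β 2 then 1 else 0)

end HalfSpaceHermite

end

namespace HalfSpaceHermite

/-! The weight cancels one of the two Gaussians, so each pairing is a product of one-variable
integrals of `He m * He n * exp (-x ^ 2 / 2)`. Integrating the derivative of that function gives a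
recursion lowering both indices. On the whole line it has no boundary term and yields orthogonality.
On the half-line the boundary term at `0` is the source of `K`, and the recursion becomes that of
`S` (`integral_Ioi_He_mul_He`).

For the series, the normalized basis functions are orthonormal in the weighted space, and
completeness is the point. If `f` is orthogonal to all of them, `f dv` annihilates every polynomial.
Since `f` has exponential moments, the Fourier integral can be expanded termwise and vanishes
(`integral_mul_cexp_eq_zero`), and hence `f = 0` almost everywhere. The cut-off is thus the sum of
its Hermite series (`hasSum_basisLp`), whose coefficients are the half-space pairings already
computed. -/

open Polynomial in
theorem derivative_hermite_succ (n : ℕ) :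
    derivative (hermite (n + 1)) = ((n : ℤ[X]) + 1) * hermite n := by
  induction n with
  | zero => simp
  | succ n ih =>
    rw [hermite_succ (n + 1), derivative_sub, derivative_mul, derivative_X, ih, derivative_mul]
    simp only [derivative_add, derivative_natCast, derivative_one]
    rw [hermite_succ n]
    push_cast
    ring

theorem He_zero (x : ℝ) : He 0 x = 1 := by simp [He]

theorem hasDerivAt_He (n : ℕ) (x : ℝ) :
    HasDerivAt (He n) (n * He (n - 1) x) x := by
  refine (Polynomial.hasDerivAt_aeval (Polynomial.hermite n) x).congr_deriv ?_
  cases n with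
  | zero => simp
  | succ n =>
    rw [derivative_hermite_succ]
    simp [He]

theorem He_succ (n : ℕ) (x : ℝ) : He (n + 1) x = x * He n x - n * He (n - 1) x := by
  have h := (Polynomial.hasDerivAt_aeval (Polynomial.hermite n) x).unique (hasDerivAt_He n x)
  rw [← h]
  simp [He, Polynomial.hermite_succ]

theorem continuous_He (n : ℕ) : Continuous (He n) :=
  continuous_iff_continuousAt.2 fun x => (hasDerivAt_He n x).continuousAt

/-! ### One-variable Gaussian pairings. -/

/-- Polynomials are integrable against the Gaussian weight. -/
theorem integrable_eval_mul_exp (p : Polynomial ℝ) :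
    Integrable fun x : ℝ => p.eval x * Real.exp (-x ^ 2 / 2) := by
  induction p using Polynomial.induction_on' with
  | add p q hp hq =>
    exact (hp.add hq).congr (.of_forall fun x => by simp [add_mul])
  | monomial n a =>
    have h := integrable_rpow_mul_exp_neg_mul_sq (b := 1 / 2) (by norm_num) (s := n)
      (by linarith [n.cast_nonneg (α := ℝ)])
    convert h.const_mul a using 2 with x
    rw [Polynomial.eval_monomial, Real.rpow_natCast, mul_assoc]
    congr 3
    ring

theorem integrable_He_mul_He (m n : ℕ) :
    Integrable fun x : ℝ => He m x * He n x * Real.exp (-x ^ 2 / 2) := by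
  have h := integrable_eval_mul_exp
    ((Polynomial.hermite m * Polynomial.hermite n).map (Int.castRingHom ℝ))
  simpa [He, Polynomial.aeval_def, Polynomial.eval_map] using h

/-- The derivatives of `He m` and of the Gaussian combine, by the three-term recurrence, into `-He
(m + 1)`. For `n = 0` the truncated index `n - 1` is harmless because its coefficient is zero. -/
theorem hasDerivAt_He_mul_He (m n : ℕ) (x : ℝ) :
    HasDerivAt (fun x : ℝ => He m x * He n x * Real.exp (-x ^ 2 / 2))
      (n * (He m x * He (n - 1) x * Real.exp (-x ^ 2 / 2)) -
        He (m + 1) x * He n x * Real.exp (-x ^ 2 / 2)) x := by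
  have he : HasDerivAt (fun x : ℝ => Real.exp (-x ^ 2 / 2)) (Real.exp (-x ^ 2 / 2) * (-x)) x := by
    have h : HasDerivAt (fun x : ℝ => -x ^ 2 / 2) (-x) x := by
      refine ((hasDerivAt_pow 2 x).neg.div_const 2).congr_deriv ?_
      push_cast
      ring
    exact h.exp
  refine (((hasDerivAt_He m x).mul (hasDerivAt_He n x)).mul he).congr_deriv ?_
  rw [He_succ]
  simp only [Pi.mul_apply]
  ring

/-- The recursion of the half-line Gaussian pairing of two Hermite polynomials. -/
theorem integral_Ioi_He_succ_mul_He (m n : ℕ) :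
    ∫ x in Set.Ioi (0 : ℝ), He (m + 1) x * He n x * Real.exp (-x ^ 2 / 2) =
      He m 0 * He n 0 +
        n * ∫ x in Set.Ioi (0 : ℝ), He m x * He (n - 1) x * Real.exp (-x ^ 2 / 2) := by
  have h1 := ((integrable_He_mul_He m (n - 1)).const_mul (n : ℝ)).integrableOn (s := Set.Ioi 0)
  have h2 := (integrable_He_mul_He (m + 1) n).integrableOn (s := Set.Ioi 0)
  have ht := tendsto_zero_of_hasDerivAt_of_integrableOn_Ioi (a := 0)
    (fun x _ => hasDerivAt_He_mul_He m n x) (h1.sub h2) (integrable_He_mul_He m n).integrableOn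
  have h := integral_Ioi_of_hasDerivAt_of_tendsto' (a := 0)
    (fun x _ => hasDerivAt_He_mul_He m n x) (h1.sub h2) ht
  rw [integral_sub h1 h2, integral_const_mul] at h
  simp only [ne_eq, OfNat.ofNat_ne_zero, not_false_eq_true, zero_pow, neg_zero, zero_div,
    Real.exp_zero, mul_one] at h
  linarith

theorem integral_He_succ_mul_He (m n : ℕ) :
    ∫ x : ℝ, He (m + 1) x * He n x * Real.exp (-x ^ 2 / 2) =
      n * ∫ x : ℝ, He m x * He (n - 1) x * Real.exp (-x ^ 2 / 2) := by
  have h1 := (integrable_He_mul_He m (n - 1)).const_mul (n : ℝ)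
  have h2 := integrable_He_mul_He (m + 1) n
  have h := integral_eq_zero_of_hasDerivAt_of_integrable
    (fun x => hasDerivAt_He_mul_He m n x) (h1.sub h2) (integrable_He_mul_He m n)
  rw [integral_sub h1 h2, integral_const_mul] at h
  linarith

/-- Orthogonality of the Hermite polynomials. -/
theorem integral_He_mul_He (m n : ℕ) :
    ∫ x : ℝ, He m x * He n x * Real.exp (-x ^ 2 / 2) =
      if m = n then Real.sqrt (2 * Real.pi) * m.factorial else 0 := by
  induction m generalizing n with
  | zero =>
    cases n with
    | zero =>
      have h := integral_gaussian (1 / 2)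
      have hp : Real.pi / (1 / 2) = 2 * Real.pi := by ring
      rw [hp] at h
      simp only [He_zero, ↓reduceIte, Nat.factorial_zero, Nat.cast_one, mul_one, one_mul, ← h]
      congr 1
      ext x
      ring_nf
    | succ n =>
      -- The recursion lowers the first index, so the case `m = 0` uses the symmetry of the pairing.
      have h := integral_He_succ_mul_He n 0
      simpa [mul_comm (He 0 _)] using h
  | succ m ih =>
    rw [integral_He_succ_mul_He]
    cases n with
    | zero => simp
    | succ n =>
      rw [Nat.add_sub_cancel, ih]
      by_cases h : m = n
      · subst h
        simp only [↓reduceIte, Nat.factorial_succ]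
        push_cast
        ring
      · simp [h]

/-- Dividing the half-line recursion by `√(2π) m!` turns the boundary term into `K m n` and the
factor `n` into `n / m`. For `m = 0 < n` the two factors are swapped first, whence `K 1 (n - 1)`. -/
theorem integral_Ioi_He_mul_He (m n : ℕ) :
    ∫ x in Set.Ioi (0 : ℝ), He m x * He n x * Real.exp (-x ^ 2 / 2) =
      Real.sqrt (2 * Real.pi) * m.factorial * S m n := by
  have hs : Real.sqrt (2 * Real.pi) ≠ 0 := (Real.sqrt_pos.2 (by positivity)).ne'
  induction m generalizing n with
  | zero =>
    cases n with
    | zero =>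
      have h := integral_gaussian_Ioi (1 / 2)
      have hp : Real.pi / (1 / 2) = 2 * Real.pi := by ring
      rw [hp] at h
      simp only [He_zero, Nat.factorial_zero, Nat.cast_one, mul_one, one_mul, S]
      rw [mul_one_div, ← h]
      congr 1
      ext x
      ring_nf
    | succ n =>
      have h := integral_Ioi_He_succ_mul_He n 0
      simp only [Nat.cast_zero, zero_mul, add_zero] at h
      simp only [mul_comm (He 0 _), h, S, K]
      simp only [He_zero, Nat.factorial_zero, zero_add, Nat.factorial_one, Nat.cast_one]
      field_simp
  | succ m ih =>
    have hf : (((m + 1).factorial : ℕ) : ℝ) ≠ 0 := by positivity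
    rw [integral_Ioi_He_succ_mul_He]
    cases n with
    | zero =>
      simp only [S, K, Nat.cast_zero, zero_mul, add_zero]
      field_simp
    | succ n =>
      rw [Nat.add_sub_cancel, ih]
      simp only [S, K]
      rw [Nat.factorial_succ] at hf ⊢
      push_cast at hf ⊢
      field_simp

/-! ### Factorization over coordinates and the half-space coefficients. -/

/-- The product set of velocities whose `d`-th coordinate lies in `A d`. -/
def box (A : Fin 3 → Set ℝ) : Set Vel := {v | ∀ d, v d ∈ A d}

theorem measurableSet_box {A : Fin 3 → Set ℝ} (hA : ∀ d, MeasurableSet (A d)) :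
    MeasurableSet (box A) := by
  have : box A = ⋂ d, (fun v : Vel => v d) ⁻¹' A d := by
    ext v
    simp [box]
  rw [this]
  exact MeasurableSet.iInter fun d => (by fun_prop : Measurable fun v : Vel => v d) (hA d)

theorem indicator_box_prod (A : Fin 3 → Set ℝ) (f : Fin 3 → ℝ → ℝ) (v : Vel) :
    (box A).indicator (fun v => ∏ d, f d (v d)) v = ∏ d, (A d).indicator (f d) (v d) := by
  by_cases hv : v ∈ box A
  · rw [Set.indicator_of_mem hv]
    exact Finset.prod_congr rfl fun d _ => (Set.indicator_of_mem (hv d) _).symm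
  · rw [Set.indicator_of_notMem hv]
    obtain ⟨d, hd⟩ : ∃ d, v d ∉ A d := by simpa [box] using hv
    exact (Finset.prod_eq_zero (Finset.mem_univ d) (Set.indicator_of_notMem hd _)).symm

theorem integrableOn_box_prod {A : Fin 3 → Set ℝ} (hA : ∀ d, MeasurableSet (A d))
    {f : Fin 3 → ℝ → ℝ} (hf : ∀ d, IntegrableOn (f d) (A d)) :
    IntegrableOn (fun v : Vel => ∏ d, f d (v d)) (box A) := by
  rw [← integrable_indicator_iff (measurableSet_box hA), ←
    (PiLp.volume_preserving_toLp (Fin 3)).integrable_comp_emb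
      (MeasurableEquiv.toLp 2 _).measurableEmbedding]
  refine (Integrable.fintype_prod (f := fun d => (A d).indicator (f d))
    fun d => (integrable_indicator_iff (hA d)).2 (hf d)).congr (.of_forall fun v => ?_)
  simp [indicator_box_prod]

theorem setIntegral_box_prod {A : Fin 3 → Set ℝ} (hA : ∀ d, MeasurableSet (A d))
    (f : Fin 3 → ℝ → ℝ) :
    ∫ v in box A, ∏ d, f d (v d) = ∏ d, ∫ x in A d, f d x := by
  rw [← integral_indicator (measurableSet_box hA), ←
    (PiLp.volume_preserving_toLp (Fin 3)).integral_comp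
      (MeasurableEquiv.toLp 2 _).measurableEmbedding]
  simp only [indicator_box_prod, ← integral_indicator (hA _)]
  exact integral_fintype_prod_volume_eq_prod fun d => (A d).indicator (f d)

theorem one_div_two_pi :
    1 / (2 * Real.pi) = 1 / Real.sqrt (2 * Real.pi) * (1 / Real.sqrt (2 * Real.pi)) := by
  rw [div_mul_div_comm, one_mul, Real.mul_self_sqrt (by positivity)]

theorem integrandI_eq_prod (θ : ℝ) (α β : MIdx) (v : Vel) :
    integrandI θ α β v =
      ∏ d, (1 / (2 * Real.pi) * θ ^ (-((α d : ℝ) + 1) / 2) * θ ^ (-((β d : ℝ) + 1) / 2)) *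
        (He (α d) (v d) * He (β d) (v d) * Real.exp (-(v d) ^ 2 / 2)) := by
  have he : Real.exp (‖v‖ ^ 2 / 2) = ∏ d, Real.exp ((v d) ^ 2 / 2) := by
    rw [← Real.exp_sum, EuclideanSpace.norm_sq_eq, Finset.sum_div]
    simp
  rw [integrandI, basisH, basisH, he, ← Finset.prod_mul_distrib, ← Finset.prod_mul_distrib]
  refine Finset.prod_congr rfl fun d _ => ?_
  have hx : Real.exp (-(v d) ^ 2 / 2) * Real.exp ((v d) ^ 2 / 2) = 1 := by
    rw [← Real.exp_add]
    ring_nf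
    simp
  rw [one_div_two_pi]
  calc _ = 1 / Real.sqrt (2 * Real.pi) * (1 / Real.sqrt (2 * Real.pi)) *
        θ ^ (-((α d : ℝ) + 1) / 2) * θ ^ (-((β d : ℝ) + 1) / 2) *
        (He (α d) (v d) * He (β d) (v d) * Real.exp (-(v d) ^ 2 / 2)) *
        (Real.exp (-(v d) ^ 2 / 2) * Real.exp ((v d) ^ 2 / 2)) := by ring
    _ = _ := by
      rw [hx]
      ring

theorem normC_eq_prod (θ : ℝ) (α : MIdx) :
    normC θ α = ∏ d, Real.sqrt (2 * Real.pi) * θ ^ (α d + 1) / (α d).factorial := by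
  have hs : (2 * Real.pi) ^ (3 / 2 : ℝ) = Real.sqrt (2 * Real.pi) ^ 3 := by
    rw [Real.sqrt_eq_rpow, ← Real.rpow_natCast, ← Real.rpow_mul (by positivity)]
    norm_num
  simp only [normC, hs, Fin.prod_univ_three, Fin.sum_univ_three]
  field_simp
  ring

theorem integrableOn_integrandI_box (θ : ℝ) (α β : MIdx) {A : Fin 3 → Set ℝ}
    (hA : ∀ d, MeasurableSet (A d)) : IntegrableOn (integrandI θ α β) (box A) := by
  simp only [funext (integrandI_eq_prod θ α β)]
  exact integrableOn_box_prod hA (f := fun d x =>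
    (1 / (2 * Real.pi) * θ ^ (-((α d : ℝ) + 1) / 2) * θ ^ (-((β d : ℝ) + 1) / 2)) *
        (He (α d) x * He (β d) x * Real.exp (-x ^ 2 / 2)))
    fun d => ((integrable_He_mul_He _ _).const_mul _).integrableOn

theorem normC_mul_setIntegral_box {θ : ℝ} (hθ : 0 < θ) (α β : MIdx) {A : Fin 3 → Set ℝ}
    (hA : ∀ d, MeasurableSet (A d)) :
    normC θ α * ∫ v in box A, integrandI θ α β v =
      ∏ d, θ ^ (((α d : ℝ) - β d) / 2) *
        ((∫ x in A d, He (α d) x * He (β d) x * Real.exp (-x ^ 2 / 2)) /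
          (Real.sqrt (2 * Real.pi) * (α d).factorial)) := by
  simp only [funext (integrandI_eq_prod θ α β)]
  rw [setIntegral_box_prod hA fun d x =>
    (1 / (2 * Real.pi) * θ ^ (-((α d : ℝ) + 1) / 2) * θ ^ (-((β d : ℝ) + 1) / 2)) *
        (He (α d) x * He (β d) x * Real.exp (-x ^ 2 / 2)),
    normC_eq_prod, ← Finset.prod_mul_distrib]
  refine Finset.prod_congr rfl fun d _ => ?_
  rw [integral_const_mul]
  -- The powers of `θ` from the normalization and both basis functions leave the exponent `(α d - β
  -- d) / 2`.
  have hp : θ ^ (α d + 1) * (θ ^ (-((α d : ℝ) + 1) / 2) * θ ^ (-((β d : ℝ) + 1) / 2)) =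
      θ ^ (((α d : ℝ) - β d) / 2) := by
    rw [← Real.rpow_natCast, ← Real.rpow_add hθ, ← Real.rpow_add hθ]
    congr 1
    push_cast
    ring
  have hs0 : Real.sqrt (2 * Real.pi) ≠ 0 := (Real.sqrt_pos.2 (by positivity)).ne'
  rw [← hp, one_div_two_pi]
  field_simp

theorem halfSpace_eq_box :
    halfSpace = box fun d => if d = 1 then Set.Ici 0 else Set.univ := by
  ext v
  simp [halfSpace, box]

theorem measurableSet_halfSpace_factor (d : Fin 3) :
    MeasurableSet (if d = 1 then Set.Ici 0 else Set.univ : Set ℝ) := by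
  split_ifs
  · exact measurableSet_Ici
  · exact MeasurableSet.univ

theorem measurableSet_halfSpace : MeasurableSet halfSpace :=
  halfSpace_eq_box ▸ measurableSet_box measurableSet_halfSpace_factor

theorem integrableOn_integrandI_halfSpace (θ : ℝ) (α β : MIdx) :
    IntegrableOn (integrandI θ α β) halfSpace :=
  halfSpace_eq_box ▸ integrableOn_integrandI_box θ α β measurableSet_halfSpace_factor

theorem rpow_mul_integral_He_mul_He (θ : ℝ) (m n : ℕ) :
    θ ^ (((m : ℝ) - n) / 2) * ((∫ x : ℝ, He m x * He n x * Real.exp (-x ^ 2 / 2)) /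
      (Real.sqrt (2 * Real.pi) * m.factorial)) = if m = n then 1 else 0 := by
  have hs0 : Real.sqrt (2 * Real.pi) ≠ 0 := (Real.sqrt_pos.2 (by positivity)).ne'
  have hf : (m.factorial : ℝ) ≠ 0 := by positivity
  rw [integral_He_mul_He]
  split_ifs with h
  · subst h
    rw [div_self (mul_ne_zero hs0 hf)]
    simp
  · simp

theorem normC_mul_setIntegral_halfSpace {θ : ℝ} (hθ : 0 < θ) (α β : MIdx) :
    normC θ α * ∫ v in halfSpace, integrandI θ α β v = coeffI θ α β := by
  have hs0 : Real.sqrt (2 * Real.pi) ≠ 0 := (Real.sqrt_pos.2 (by positivity)).ne'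
  have hf : ((α 1).factorial : ℝ) ≠ 0 := by positivity
  rw [halfSpace_eq_box, normC_mul_setIntegral_box hθ α β measurableSet_halfSpace_factor,
    Fin.prod_univ_three]
  simp only [Fin.reduceEq, ↓reduceIte, Measure.restrict_univ, rpow_mul_integral_He_mul_He,
    integral_Ici_eq_integral_Ioi, integral_Ioi_He_mul_He]
  rw [mul_div_cancel_left₀ _ (mul_ne_zero hs0 hf), coeffI]
  ring

theorem box_univ : (box fun _ => Set.univ) = Set.univ := by
  ext v
  simp [box]

theorem integrable_integrandI (θ : ℝ) (α β : MIdx) : Integrable (integrandI θ α β) := by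
  have h := integrableOn_integrandI_box θ α β (A := fun _ => Set.univ) fun _ => .univ
  rwa [box_univ, integrableOn_univ] at h

/-- Orthogonality of the basis functions. -/
theorem normC_mul_integral_integrandI {θ : ℝ} (hθ : 0 < θ) (α β : MIdx) :
    normC θ α * ∫ v, integrandI θ α β v = if α = β then 1 else 0 := by
  have h := normC_mul_setIntegral_box hθ α β (A := fun _ => Set.univ) fun _ => .univ
  simp only [box_univ, Measure.restrict_univ, rpow_mul_integral_He_mul_He,
    Finset.prod_ite_zero] at h
  rw [h]
  simp [funext_iff]

/-! ### The weighted measure. -/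

theorem continuous_weight_density : Continuous fun v : Vel => Real.exp (‖v‖ ^ 2 / 2) := by
  fun_prop

theorem integrable_weight_iff {f : Vel → ℝ} :
    Integrable f weight ↔ Integrable fun v => f v * Real.exp (‖v‖ ^ 2 / 2) := by
  rw [weight, integrable_withDensity_iff_integrable_smul'
    continuous_weight_density.measurable.ennreal_ofReal (.of_forall fun _ => ENNReal.ofReal_lt_top)]
  simp only [ENNReal.toReal_ofReal (Real.exp_pos _).le, smul_eq_mul, mul_comm]

theorem integral_weight (f : Vel → ℝ) :
    ∫ v, f v ∂weight = ∫ v, f v * Real.exp (‖v‖ ^ 2 / 2) := by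
  rw [weight, integral_withDensity_eq_integral_toReal_smul
    continuous_weight_density.measurable.ennreal_ofReal (.of_forall fun _ => ENNReal.ofReal_lt_top)]
  simp only [ENNReal.toReal_ofReal (Real.exp_pos _).le, smul_eq_mul, mul_comm]

theorem volume_absolutelyContinuous_weight : (volume : Measure Vel) ≪ weight :=
  withDensity_absolutelyContinuous'
    continuous_weight_density.measurable.ennreal_ofReal.aemeasurable
    (.of_forall fun _ => (ENNReal.ofReal_pos.2 (Real.exp_pos _)).ne')

theorem weight_absolutelyContinuous_volume : weight ≪ (volume : Measure Vel) :=
  withDensity_absolutelyContinuous _ _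

theorem continuous_basisH (θ : ℝ) (α : MIdx) : Continuous (basisH θ α) := by
  unfold basisH
  have h := fun d => continuous_He (α d)
  fun_prop

theorem memLp_basisH (θ : ℝ) (α : MIdx) : MemLp (basisH θ α) 2 weight := by
  rw [memLp_two_iff_integrable_sq (continuous_basisH θ α).aestronglyMeasurable,
    integrable_weight_iff]
  exact (integrable_integrandI θ α α).congr (.of_forall fun v => by simp only [integrandI, sq])

/-! ### Completeness. -/

/-- The product of Hermite polynomials in the three coordinates. -/
noncomputable def hermiteProd (α : MIdx) (v : Vel) : ℝ := ∏ d, He (α d) (v d)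

/-- Weighted pairings with the basis are thereby Lebesgue pairings with polynomials. -/
theorem basisH_mul_exp (θ : ℝ) (α : MIdx) (v : Vel) :
    basisH θ α v * Real.exp (‖v‖ ^ 2 / 2) =
      (∏ d, 1 / Real.sqrt (2 * Real.pi) * θ ^ (-((α d : ℝ) + 1) / 2)) * hermiteProd α v := by
  have he : Real.exp (‖v‖ ^ 2 / 2) = ∏ d, Real.exp ((v d) ^ 2 / 2) := by
    rw [← Real.exp_sum, EuclideanSpace.norm_sq_eq, Finset.sum_div]
    simp
  rw [basisH, he, hermiteProd, ← Finset.prod_mul_distrib, ← Finset.prod_mul_distrib]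
  refine Finset.prod_congr rfl fun d _ => ?_
  rw [mul_assoc, ← Real.exp_add, neg_div (2 : ℝ) (v d ^ 2), neg_add_cancel, Real.exp_zero, mul_one]

theorem coord_mul_hermiteProd (α : MIdx) (d : Fin 3) (v : Vel) :
    v d * hermiteProd α v = hermiteProd (Function.update α d (α d + 1)) v +
      (α d : ℝ) * hermiteProd (Function.update α d (α d - 1)) v := by
  simp only [hermiteProd, Fin.prod_univ_three]
  fin_cases d <;> simp [Function.update, He_succ] <;> ring

/-- The span of the products of Hermite polynomials. -/
noncomputable def hermiteSpan : Submodule ℝ (Vel → ℝ) := Submodule.span ℝ (Set.range hermiteProd)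

theorem coord_mul_mem_hermiteSpan (d : Fin 3) {p : Vel → ℝ} (hp : p ∈ hermiteSpan) :
    (fun v => v d * p v) ∈ hermiteSpan := by
  induction hp using Submodule.span_induction with
  | mem p hp =>
    obtain ⟨α, rfl⟩ := hp
    rw [funext (coord_mul_hermiteProd α d)]
    exact add_mem (Submodule.subset_span ⟨_, rfl⟩)
      (Submodule.smul_mem _ (α d : ℝ) (Submodule.subset_span ⟨_, rfl⟩))
  | zero =>
    simp only [Pi.zero_apply, mul_zero]
    exact hermiteSpan.zero_mem
  | add p q _ _ hp hq =>
    simp only [Pi.add_apply, mul_add]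
    exact add_mem hp hq
  | smul a p _ hp =>
    simp only [Pi.smul_apply, smul_eq_mul, mul_left_comm _ a]
    exact Submodule.smul_mem _ a hp

theorem inner_pow_mem_hermiteSpan (ξ : Vel) (k : ℕ) :
    (fun v : Vel => inner ℝ v ξ ^ k) ∈ hermiteSpan := by
  induction k with
  | zero =>
    refine Submodule.subset_span ⟨0, ?_⟩
    ext v
    simp [hermiteProd, He_zero]
  | succ k ih =>
    have h : (fun v : Vel => inner ℝ v ξ ^ (k + 1)) =
        ∑ d, ξ d • fun v : Vel => v d * inner ℝ v ξ ^ k := by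
      ext v
      simp only [Finset.sum_apply, Pi.smul_apply, smul_eq_mul, ← mul_assoc, ← Finset.sum_mul,
        pow_succ']
      congr 1
    rw [h]
    exact Submodule.sum_mem _ fun d _ => Submodule.smul_mem _ _ (coord_mul_mem_hermiteSpan d ih)

theorem integrable_mul_hermiteProd {f : Vel → ℝ} (hf : MemLp f 2 weight) (α : MIdx) :
    Integrable fun v => f v * hermiteProd α v := by
  -- Any positive `θ` would serve; `θ = 1` removes the powers from the constant.
  have h := integrable_weight_iff.1 (hf.integrable_mul (memLp_basisH 1 α))
  refine (h.mul_const (∏ d : Fin 3, 1 / Real.sqrt (2 * Real.pi))⁻¹).congr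
    (.of_forall fun v => ?_)
  have hs : (∏ d : Fin 3, 1 / Real.sqrt (2 * Real.pi)) ≠ 0 :=
    Finset.prod_ne_zero_iff.2 fun d _ => by positivity
  simp only [Pi.mul_apply, mul_assoc (f v), basisH_mul_exp, Real.one_rpow, mul_one]
  field_simp

theorem integral_mul_hermiteProd_eq_zero {θ : ℝ} (hθ : 0 < θ) {f : Vel → ℝ} (α : MIdx)
    (h : ∫ v, f v * basisH θ α v ∂weight = 0) : ∫ v, f v * hermiteProd α v = 0 := by
  have hs : (∏ d, 1 / Real.sqrt (2 * Real.pi) * θ ^ (-((α d : ℝ) + 1) / 2)) ≠ 0 :=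
    Finset.prod_ne_zero_iff.2 fun d _ => by positivity
  rw [integral_weight] at h
  simp only [mul_assoc, basisH_mul_exp, mul_left_comm (f _)] at h
  rw [integral_const_mul] at h
  exact (mul_eq_zero.1 h).resolve_left hs

theorem integral_mul_hermiteSpan_eq_zero {f : Vel → ℝ} (hf : MemLp f 2 weight)
    (h : ∀ α, ∫ v, f v * hermiteProd α v = 0) {p : Vel → ℝ} (hp : p ∈ hermiteSpan) :
    Integrable (fun v => f v * p v) ∧ ∫ v, f v * p v = 0 := by
  induction hp using Submodule.span_induction with
  | mem p hp =>
    obtain ⟨α, rfl⟩ := hp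
    exact ⟨integrable_mul_hermiteProd hf α, h α⟩
  | zero => simp
  | add p q _ _ hp hq =>
    simp only [Pi.add_apply, mul_add]
    refine ⟨hp.1.add hq.1, ?_⟩
    rw [integral_add hp.1 hq.1, hp.2, hq.2, add_zero]
  | smul a p _ hp =>
    simp only [Pi.smul_apply, smul_eq_mul, mul_left_comm _ a]
    refine ⟨hp.1.const_mul a, ?_⟩
    rw [integral_const_mul, hp.2, mul_zero]

theorem integrable_mul_exp_inner {f : Vel → ℝ} (hf : MemLp f 2 weight) (ξ : Vel) :
    Integrable fun v => f v * Real.exp (inner ℝ v ξ) := by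
  -- This function times the weight density is `exp ⟨v, ξ⟩`, and its weighted square is a shifted
  -- Gaussian, so Hölder applies against `f`.
  have hG : MemLp (fun v : Vel => Real.exp (inner ℝ v ξ - ‖v‖ ^ 2 / 2)) 2 weight := by
    rw [memLp_two_iff_integrable_sq (by fun_prop), integrable_weight_iff]
    have h := (GaussianFourier.integrable_cexp_neg_mul_sq_norm_add (V := Vel) (b := 1 / 2)
      (by norm_num) 2 ξ).norm
    refine h.congr (.of_forall fun v => ?_)
    have hz : -(1 / 2) * (‖v‖ : ℂ) ^ 2 + 2 * (inner ℝ ξ v : ℝ) =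
        ((2 * inner ℝ v ξ - ‖v‖ ^ 2 / 2 : ℝ) : ℂ) := by
      rw [real_inner_comm v ξ]
      push_cast
      ring
    dsimp only
    rw [hz, Complex.norm_exp_ofReal, ← Real.exp_nat_mul, ← Real.exp_add]
    congr 1
    push_cast
    ring
  refine (integrable_weight_iff.1 (hf.integrable_mul hG)).congr (.of_forall fun v => ?_)
  simp only [Pi.mul_apply, mul_assoc, ← Real.exp_add]
  ring_nf

/-- From `exp |t| ≤ exp t + exp (-t)`; this dominates the power series of the Fourier kernel. -/
theorem integrable_mul_exp_abs_inner {f : Vel → ℝ} (hf : MemLp f 2 weight) (ξ : Vel) :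
    Integrable fun v => |f v| * Real.exp |inner ℝ v ξ| := by
  have h1 := (integrable_mul_exp_inner hf ξ).norm
  have h2 := (integrable_mul_exp_inner hf (-ξ)).norm
  have hm : AEStronglyMeasurable f volume :=
    hf.aestronglyMeasurable.mono_ac volume_absolutelyContinuous_weight
  refine (h1.add h2).mono' (by fun_prop) (.of_forall fun v => ?_)
  simp only [Pi.add_apply, norm_mul, Real.norm_eq_abs, abs_abs, Real.abs_exp, inner_neg_right,
    ← mul_add]
  gcongr
  rcases abs_cases (inner ℝ v ξ) with ⟨h, -⟩ | ⟨h, -⟩ <;> rw [h] <;>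
    linarith [Real.exp_pos (inner ℝ v ξ), Real.exp_pos (-inner ℝ v ξ)]

/-- A function all of whose moments vanish has vanishing Fourier transform. -/
theorem integral_mul_cexp_eq_zero {f : Vel → ℝ} (hf : MemLp f 2 weight)
    (h : ∀ α, ∫ v, f v * hermiteProd α v = 0) (ξ : Vel) :
    ∫ v, (f v : ℂ) * Complex.exp (inner ℝ v ξ * Complex.I) = 0 := by
  have hm : AEStronglyMeasurable f volume :=
    hf.aestronglyMeasurable.mono_ac volume_absolutelyContinuous_weight
  have hsum (v : Vel) : HasSum (fun k : ℕ => |f v| * (|inner ℝ v ξ| ^ k / k.factorial))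
      (|f v| * Real.exp |inner ℝ v ξ|) := by
    rw [Real.exp_eq_exp_ℝ]
    exact (NormedSpace.exp_series_hasSum_exp' (𝕂 := ℝ) |inner ℝ v ξ|).mul_left _
      |>.congr_fun (by intro; simp [div_eq_inv_mul])
  have key := hasSum_integral_of_dominated_convergence (μ := (volume : Measure Vel))
    (F := fun (k : ℕ) v => (f v : ℂ) * ((inner ℝ v ξ * Complex.I) ^ k / k.factorial))
    (f := fun v => (f v : ℂ) * Complex.exp (inner ℝ v ξ * Complex.I))
    (fun k v => |f v| * (|inner ℝ v ξ| ^ k / k.factorial))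
    (fun k => by fun_prop)
    (fun k => .of_forall fun v => by simp)
    (.of_forall fun v => (hsum v).summable)
    ((integrable_mul_exp_abs_inner hf ξ).congr (.of_forall fun v => (hsum v).tsum_eq.symm))
    (.of_forall fun v => by
      rw [Complex.exp_eq_exp_ℂ]
      exact ((NormedSpace.expSeries_div_hasSum_exp (inner ℝ v ξ * Complex.I : ℂ)).mul_left _))
  refine key.unique ?_
  convert hasSum_zero with k
  have h0 := (integral_mul_hermiteSpan_eq_zero hf h (inner_pow_mem_hermiteSpan ξ k)).2
  have he (v : Vel) : (f v : ℂ) * ((inner ℝ v ξ * Complex.I) ^ k / k.factorial) =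
      (Complex.I ^ k / k.factorial) * ((f v * inner ℝ v ξ ^ k : ℝ) : ℂ) := by
    push_cast
    ring
  simp only [he]
  rw [integral_const_mul, integral_complex_ofReal, h0]
  simp

/-- An integrable function with vanishing Fourier transform vanishes almost everywhere. -/
theorem ae_eq_zero_of_integral_mul_cexp_eq_zero {f : Vel → ℝ} (hf : Integrable f)
    (h : ∀ ξ : Vel, ∫ v, (f v : ℂ) * Complex.exp (inner ℝ v ξ * Complex.I) = 0) :
    f =ᵐ[volume] 0 := by
  have hp : AEMeasurable (fun v => ENNReal.ofReal (f v)) volume := hf.aemeasurable.ennreal_ofReal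
  have hn : AEMeasurable (fun v => ENNReal.ofReal (-f v)) volume :=
    hf.neg.aemeasurable.ennreal_ofReal
  have fp := isFiniteMeasure_withDensity_ofReal hf.2
  have fn := isFiniteMeasure_withDensity_ofReal hf.neg.2
  have hi {u : Vel → ℝ} (hu : Integrable u) (ξ : Vel) : Integrable fun v =>
      (ENNReal.ofReal (u v)).toReal • Complex.exp (inner ℝ v ξ * Complex.I) := by
    simp only [ENNReal.toReal_ofReal', Complex.real_smul]
    have hm := hu.pos_part.aestronglyMeasurable
    refine hu.pos_part.norm.mono' (by fun_prop) (.of_forall fun v => ?_)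
    rw [norm_mul, Complex.norm_exp_ofReal_mul_I, mul_one, Complex.norm_real]
  -- The positive and negative parts of `f` define finite measures with equal characteristic
  -- functions.
  have hE : volume.withDensity (fun v => ENNReal.ofReal (f v)) =
      volume.withDensity (fun v => ENNReal.ofReal (-f v)) := by
    refine @Measure.ext_of_charFun _ _ _ _ _ _ _ _ _ fp fn ?_
    ext ξ
    rw [charFun_apply, charFun_apply,
      integral_withDensity_eq_integral_toReal_smul₀ hp (.of_forall fun _ => ENNReal.ofReal_lt_top),
      integral_withDensity_eq_integral_toReal_smul₀ hn (.of_forall fun _ => ENNReal.ofReal_lt_top),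
      ← sub_eq_zero, ← integral_sub, ← h ξ]
    · congr 1
      ext v
      rw [← sub_smul, ENNReal.toReal_ofReal', ENNReal.toReal_ofReal', max_zero_sub_max_neg_zero_eq_self,
        Complex.real_smul]
    · exact hi hf ξ
    · exact hi hf.neg ξ
  rw [withDensity_eq_iff hp hn hf.lintegral_lt_top.ne] at hE
  filter_upwards [hE] with v hv
  have := congrArg ENNReal.toReal hv
  rw [ENNReal.toReal_ofReal', ENNReal.toReal_ofReal'] at this
  simp only [Pi.zero_apply]
  have h3 := max_zero_sub_max_neg_zero_eq_self (f v)
  linarith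

/-- Completeness of the Hermite functions in the weighted space. -/
theorem ae_eq_zero_of_orthogonal_basisH {θ : ℝ} (hθ : 0 < θ) {f : Vel → ℝ}
    (hf : MemLp f 2 weight) (h : ∀ α, ∫ v, f v * basisH θ α v ∂weight = 0) :
    f =ᵐ[weight] 0 := by
  refine weight_absolutelyContinuous_volume.ae_le
    (ae_eq_zero_of_integral_mul_cexp_eq_zero ?_ fun ξ => integral_mul_cexp_eq_zero hf
      (fun α => integral_mul_hermiteProd_eq_zero hθ α (h α)) ξ)
  simpa [hermiteProd, He_zero] using integrable_mul_hermiteProd hf 0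

/-! ### The Hilbert basis and the expansion of the cut-off. -/

/-- The class of a basis function in the weighted `L²` space. -/
noncomputable def basisLp (θ : ℝ) (α : MIdx) : Lp ℝ 2 weight := (memLp_basisH θ α).toLp (basisH θ α)

theorem inner_basisLp (θ : ℝ) (α : MIdx) (f : Lp ℝ 2 weight) :
    inner ℝ (basisLp θ α) f = ∫ v, f v * basisH θ α v ∂weight := by
  rw [L2.inner_def]
  refine integral_congr_ae ?_
  filter_upwards [(memLp_basisH θ α).coeFn_toLp] with v hv
  rw [basisLp, hv]
  rfl

theorem normC_pos {θ : ℝ} (hθ : 0 < θ) (α : MIdx) : 0 < normC θ α := by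
  unfold normC
  positivity

theorem inner_basisLp_basisLp {θ : ℝ} (hθ : 0 < θ) (α β : MIdx) :
    inner ℝ (basisLp θ α) (basisLp θ β) = if α = β then (normC θ α)⁻¹ else 0 := by
  have h : inner ℝ (basisLp θ α) (basisLp θ β) = ∫ v, integrandI θ α β v := by
    unfold integrandI
    rw [inner_basisLp, ← integral_weight fun v => basisH θ α v * basisH θ β v]
    refine integral_congr_ae ?_
    filter_upwards [(memLp_basisH θ β).coeFn_toLp] with v hv
    rw [basisLp, hv, mul_comm]
  have h2 := normC_mul_integral_integrandI hθ α β
  rw [← h] at h2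
  have h0 := (normC_pos hθ α).ne'
  split_ifs at h2 ⊢ with hab
  · exact eq_inv_of_mul_eq_one_right h2
  · exact (mul_eq_zero.1 h2).resolve_left h0

theorem orthonormal_sqrt_normC_smul_basisLp {θ : ℝ} (hθ : 0 < θ) :
    Orthonormal ℝ fun α => Real.sqrt (normC θ α) • basisLp θ α := by
  classical
  rw [orthonormal_iff_ite]
  intro α β
  rw [real_inner_smul_left, real_inner_smul_right, inner_basisLp_basisLp hθ]
  split_ifs with h
  · subst h
    rw [← mul_assoc, Real.mul_self_sqrt (normC_pos hθ α).le, mul_inv_cancel₀ (normC_pos hθ α).ne']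
  · simp

theorem orthogonal_span_basisLp {θ : ℝ} (hθ : 0 < θ) :
    (Submodule.span ℝ (Set.range fun α => Real.sqrt (normC θ α) • basisLp θ α))ᗮ = ⊥ := by
  rw [Submodule.eq_bot_iff]
  intro f hf
  refine (Lp.eq_zero_iff_ae_eq_zero).2 (ae_eq_zero_of_orthogonal_basisH hθ (Lp.memLp f) fun α => ?_)
  have h := (Submodule.mem_orthogonal _ _).1 hf _ (Submodule.subset_span ⟨α, rfl⟩)
  rw [real_inner_smul_left, inner_basisLp] at h
  exact (mul_eq_zero.1 h).resolve_left (Real.sqrt_pos.2 (normC_pos hθ α)).ne'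

/-- Every element of the weighted `L²` space is the sum of its Hermite series. -/
theorem hasSum_basisLp {θ : ℝ} (hθ : 0 < θ) (f : Lp ℝ 2 weight) :
    HasSum (fun α => (normC θ α * ∫ v, f v * basisH θ α v ∂weight) • basisLp θ α) f := by
  have h := (HilbertBasis.mkOfOrthogonalEqBot (orthonormal_sqrt_normC_smul_basisLp hθ)
    (orthogonal_span_basisLp hθ)).hasSum_repr f
  -- The factor `√C` occurs once in the coefficient and once in the basis vector, giving `C`.
  convert h using 2 with α
  rw [HilbertBasis.repr_apply_apply, HilbertBasis.coe_mkOfOrthogonalEqBot, real_inner_smul_left,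
    inner_basisLp, smul_smul, mul_right_comm, Real.mul_self_sqrt (normC_pos hθ α).le]

theorem memLp_cutoff {g : Vel → ℝ} (hg : MemLp g 2 weight) : MemLp (cutoff g) 2 weight :=
  hg.indicator measurableSet_halfSpace

theorem memLp_sum_basisH (θ : ℝ) (s : Finset MIdx) (c : MIdx → ℝ) :
    MemLp (fun v => ∑ β ∈ s, c β * basisH θ β v) 2 weight :=
  memLp_finsetSum s fun β _ => (memLp_basisH θ β).const_mul (c β)

/-- The Hermite coefficients of the cut-off of a finite Hermite expansion. -/
theorem normC_mul_integral_cutoff {θ : ℝ} (hθ : 0 < θ) (s : Finset MIdx) (c : MIdx → ℝ)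
    (α : MIdx) :
    normC θ α * ∫ v, cutoff (fun v => ∑ β ∈ s, c β * basisH θ β v) v * basisH θ α v ∂weight =
      ∑ β ∈ s, c β * coeffI θ α β := by
  have h (v : Vel) : cutoff (fun v => ∑ β ∈ s, c β * basisH θ β v) v * basisH θ α v *
      Real.exp (‖v‖ ^ 2 / 2) =
      halfSpace.indicator (fun v => ∑ β ∈ s, c β * integrandI θ α β v) v := by
    by_cases hv : v ∈ halfSpace
    · simp only [cutoff, Set.indicator_of_mem hv, Finset.sum_mul, integrandI]
      exact Finset.sum_congr rfl fun β _ => by ring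
    · simp only [cutoff, Set.indicator_of_notMem hv, zero_mul]
  rw [integral_weight, funext h, integral_indicator measurableSet_halfSpace,
    integral_finsetSum s fun β _ => (integrableOn_integrandI_halfSpace θ α β).const_mul (c β),
    Finset.mul_sum]
  refine Finset.sum_congr rfl fun β _ => ?_
  rw [integral_const_mul, mul_left_comm, normC_mul_setIntegral_halfSpace hθ]

end HalfSpaceHermite

theorem proposition4p1 (M : ℕ) (θ : ℝ) (hθ : 0 < θ)
    (c : HalfSpaceHermite.MIdx → ℝ) (g : HalfSpaceHermite.Vel → ℝ)
    (hg : ∀ v, g v = ∑ β ∈ HalfSpaceHermite.idxLE (M + 1), c β * HalfSpaceHermite.basisH θ β v) :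
    -- the half-space integrals exist and are given by the closed form
    (∀ α β : HalfSpaceHermite.MIdx,
      IntegrableOn (HalfSpaceHermite.integrandI θ α β) HalfSpaceHermite.halfSpace volume ∧
      HalfSpaceHermite.normC θ α *
          ∫ v in HalfSpaceHermite.halfSpace, HalfSpaceHermite.integrandI θ α β v =
        HalfSpaceHermite.coeffI θ α β) ∧
    -- the Hermite expansion of the cut-off, in the weighted space `L²(exp(|v|²/2) dv)`
    ∃ (hH : ∀ α, MemLp (HalfSpaceHermite.basisH θ α) 2 HalfSpaceHermite.weight)
      (hcut : MemLp (HalfSpaceHermite.cutoff g) 2 HalfSpaceHermite.weight),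
      HasSum
        (fun α : HalfSpaceHermite.MIdx =>
          (∑ β ∈ HalfSpaceHermite.idxLE (M + 1), c β * HalfSpaceHermite.coeffI θ α β) •
            (hH α).toLp (HalfSpaceHermite.basisH θ α))
        (hcut.toLp (HalfSpaceHermite.cutoff g)) := by
  obtain rfl : g = fun v => ∑ β ∈ HalfSpaceHermite.idxLE (M + 1),
      c β * HalfSpaceHermite.basisH θ β v := funext hg
  refine ⟨fun α β => ⟨HalfSpaceHermite.integrableOn_integrandI_halfSpace θ α β,
    HalfSpaceHermite.normC_mul_setIntegral_halfSpace hθ α β⟩,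
    HalfSpaceHermite.memLp_basisH θ,
    HalfSpaceHermite.memLp_cutoff (HalfSpaceHermite.memLp_sum_basisH θ _ c), ?_⟩
  have hcut := HalfSpaceHermite.memLp_cutoff
    (HalfSpaceHermite.memLp_sum_basisH θ (HalfSpaceHermite.idxLE (M + 1)) c)
  convert HalfSpaceHermite.hasSum_basisLp hθ (hcut.toLp _) using 2 with α
  rw [← HalfSpaceHermite.normC_mul_integral_cutoff hθ]
  congr 2
  refine integral_congr_ae ?_
  filter_upwards [hcut.coeFn_toLp] with v hv
  rw [hv]
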